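/- All rings are associative and unital. A multiplicative set $S$ of a ring $R$ is a subset with $1\in S$, $SS\subseteq S$ and $0\notin S$. Let $R\langle S^{-1}\rangle$ be the ring freely generated by $R$ and noncommuting indeterminates $x_s$ ($s\in S$), modulo the relations $sx_s=1=x_ss$ ($s\in S$), and let $\mathrm{ass}_R(S)$ be the kernel of the canonical map $R\to R\langle S^{-1}\rangle$. Call $S$ left (resp. right) localizable if $R\langle S^{-1}\rangle\neq 0$ and every element of $R\langle S^{-1}\rangle$ has the form $s^{-1}r$ (resp. $rs^{-1}$), where $s\in S$, $r\in R$, and $r$, $s$ also denote their images. Let $\mathbb L_l(R)$ and $\mathbb L_r(R)$ be the sets of left, respectively right, localizable sets of $R$, and $\mathbb L_\emptyset(R)=\mathbb L_l(R)\cap\mathbb L_r(R)$. For a ring $A$, let $\mathcal C_A$ be the set of its regular elements (those that are neither left nor right zero divisors), $Q_{l,cl}(A)=\mathcal C_A^{-1}A$ its classical left quotient ring and $Q_{r,cl}(A)=A\mathcal C_A^{-1}$ its classical right quotient ring, when they exist; $Q_{\emptyset,cl}(A)=\mathcal C_A^{-1}A\simeq A\mathcal C_A^{-1}$ when both exist.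 The ring $A$ is left Goldie if it has finite left uniform dimension and satisfies the ascending chain condition on left annihilators; right Goldie rings are defined symmetrically, and "$\emptyset$ Goldie" means left and right Goldie. For an ideal $\mathfrak p$ of $R$ put $\mathcal C(\mathfrak p)=\{c\in R : c+\mathfrak p\in\mathcal C_{R/\mathfrak p}\}$, and let $\min(R)$ be the set of minimal prime ideals of $R$. An $R$-isomorphism is a ring isomorphism that commutes with the canonical maps from $R$. **Theorem.** Let $*\in\{l,r,\emptyset\}$, let $R$ be a ring, let $S_1,\dots,S_n\in\mathbb L_*(R)$, and put $\mathfrak p_i=\mathrm{ass}_R(S_i)$, $R_i=R/\mathfrak p_i$ and $Q_i=R\langle S_i^{-1}\rangle$. Suppose that every $Q_i$ is a simple Artinian ring, that $\bigcap_{i=1}^n\mathfrak p_i=0$, and that $\bigcap_{j\ne i}\mathfrak p_j\neq 0$ for $i=1,\dots,n$. (For $n=1$ the empty intersection is $R$.) Then: 1. every $R_i$ is a prime $*$ Goldie ring; 2. $\min(R)=\{\mathfrak p_1,\dots,\mathfrak p_n\}$; 3. for every $i$, the ring $Q_{*,cl}(R_i)$ exists and $Q_i\simeq Q_{*,cl}(R_i)$,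 an $R$-isomorphism; 4. $S_i\subseteq\mathcal C(\mathfrak p_i)$ for every $i$; 5. the ring $Q_{*,cl}(R)$ exists and $Q_{*,cl}(R)\simeq\prod_{i=1}^n Q_i$, an $R$-isomorphism; 6. for every $i$, $\mathcal C(\mathfrak p_i)$ is a maximal element, with respect to inclusion, of $\mathbb L_*(R)$. -/

import Mathlib

universe u v

namespace LocalizableSets

/-! ### The ring `R⟨S⁻¹⟩` -/

/-- The relations among the generators `[r]` (`r ∈ R`) and `x` (`x ∈ X`) saying that `r ↦ [r]`
is a ring homomorphism. -/
inductive FreeRel (R : Type u) [Ring R] (X : Type v) :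
    FreeAlgebra ℤ (R ⊕ X) → FreeAlgebra ℤ (R ⊕ X) → Prop
  | one : FreeRel R X (FreeAlgebra.ι ℤ (Sum.inl 1)) 1
  | add (a b : R) : FreeRel R X (FreeAlgebra.ι ℤ (Sum.inl (a + b)))
      (FreeAlgebra.ι ℤ (Sum.inl a) + FreeAlgebra.ι ℤ (Sum.inl b))
  | mul (a b : R) : FreeRel R X (FreeAlgebra.ι ℤ (Sum.inl (a * b)))
      (FreeAlgebra.ι ℤ (Sum.inl a) * FreeAlgebra.ι ℤ (Sum.inl b))

/-- The ring `R⟨X⟩` freely generated by the ring `R` and the set `X` of noncommuting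
indeterminates (which do not commute with the elements of `R` either). -/
abbrev FreeOver (R : Type u) [Ring R] (X : Type v) := RingQuot (FreeRel R X)

/-- The canonical ring homomorphism `R → R⟨X⟩`. -/
noncomputable def FreeOver.of (R : Type u) [Ring R] (X : Type v) : R →+* FreeOver R X where
  toFun r := RingQuot.mkRingHom (FreeRel R X) (FreeAlgebra.ι ℤ (Sum.inl r))
  map_one' := by rw [RingQuot.mkRingHom_rel FreeRel.one, map_one]
  map_mul' a b := by rw [RingQuot.mkRingHom_rel (FreeRel.mul a b), map_mul]
  map_add' a b := by rw [RingQuot.mkRingHom_rel (FreeRel.add a b), map_add]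
  map_zero' := by
    have h := RingQuot.mkRingHom_rel (FreeRel.add (R := R) (X := X) 0 0)
    rw [map_add, add_zero] at h
    exact left_eq_add.mp h

/-- The indeterminate of `R⟨X⟩` indexed by `x ∈ X`. -/
noncomputable def FreeOver.var (R : Type u) [Ring R] {X : Type v} (x : X) : FreeOver R X :=
  RingQuot.mkRingHom (FreeRel R X) (FreeAlgebra.ι ℤ (Sum.inr x))

section

variable {R : Type u} [Ring R]

/-- The relations `s * x_s = 1` and `x_s * s = 1`, for `s ∈ S`. -/
inductive InvRel (S : Submonoid R) : FreeOver R S → FreeOver R S → Prop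
  | mul_inv (s : S) : InvRel S (FreeOver.of R S s * FreeOver.var R s) 1
  | inv_mul (s : S) : InvRel S (FreeOver.var R s * FreeOver.of R S s) 1

/-- The ring `R⟨S⁻¹⟩ = R⟨X_S⟩ / (s x_s - 1, x_s s - 1 | s ∈ S)`. -/
abbrev Loc (S : Submonoid R) := RingQuot (InvRel S)

/-- The canonical ring homomorphism `R → R⟨S⁻¹⟩`. -/
noncomputable def toLoc (S : Submonoid R) : R →+* Loc S :=
  (RingQuot.mkRingHom (InvRel S)).comp (FreeOver.of R S)

/-- The inverse in `R⟨S⁻¹⟩` of the image of `s ∈ S`, i.e. the class of `x_s`. -/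
noncomputable def locInv (S : Submonoid R) (s : S) : Loc S :=
  RingQuot.mkRingHom (InvRel S) (FreeOver.var R s)

/-- `ass_R(S)`, the kernel of `R → R⟨S⁻¹⟩`. -/
noncomputable def ass (S : Submonoid R) : TwoSidedIdeal R := TwoSidedIdeal.ker (toLoc S)

/-- The ring homomorphism `R / ass_R(S) → R⟨S⁻¹⟩` induced by `R → R⟨S⁻¹⟩`. -/
noncomputable def assQuotToLoc (S : Submonoid R) : (ass S).ringCon.Quotient →+* Loc S :=
  (ass S).ringCon.lift (toLoc S) fun _ _ h => h

/-- `S` is a left localizable set: a multiplicative set (`1 ∈ S`, `SS ⊆ S`, `0 ∉ S`) such that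
`R⟨S⁻¹⟩` is nonzero and consists of left fractions `s⁻¹ r`. -/
structure IsLeftLocalizable (S : Submonoid R) : Prop where
  zero_notMem : (0 : R) ∉ S
  nontrivial : Nontrivial (Loc S)
  exists_fraction : ∀ q : Loc S, ∃ (s : S) (r : R), q = locInv S s * toLoc S r

/-- `S` is a right localizable set: a multiplicative set (`1 ∈ S`, `SS ⊆ S`, `0 ∉ S`) such that
`R⟨S⁻¹⟩` is nonzero and consists of right fractions `r s⁻¹`. -/
structure IsRightLocalizable (S : Submonoid R) : Prop where
  zero_notMem : (0 : R) ∉ S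
  nontrivial : Nontrivial (Loc S)
  exists_fraction : ∀ q : Loc S, ∃ (r : R) (s : S), q = toLoc S r * locInv S s

end

/-- The three settings "left", "right" and "left and right". -/
inductive Side
  | left
  | right
  | both

/-- `S ∈ 𝕃_*(R)` for `* ∈ {l, r, ∅}`. -/
def IsLocalizable {R : Type u} [Ring R] : Side → Submonoid R → Prop
  | .left, S => IsLeftLocalizable S
  | .right, S => IsRightLocalizable S
  | .both, S => IsLeftLocalizable S ∧ IsRightLocalizable S

/-! ### Prime ideals -/

/-- `P` is a prime ideal of the (noncommutative) ring `R`: it is proper, and `I J ⊆ P` implies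
`I ⊆ P` or `J ⊆ P` for all ideals `I`, `J` of `R`. -/
def IsPrimeIdeal {R : Type u} [Ring R] (P : TwoSidedIdeal R) : Prop :=
  P ≠ ⊤ ∧ ∀ I J : TwoSidedIdeal R, (∀ a ∈ I, ∀ b ∈ J, a * b ∈ P) → I ≤ P ∨ J ≤ P

/-- `min(R)`, the set of minimal prime ideals of `R`. -/
def minPrimes (R : Type u) [Ring R] : Set (TwoSidedIdeal R) := {P | Minimal IsPrimeIdeal P}

/-- `A` is a prime ring. -/
def IsPrimeRing (A : Type u) [Ring A] : Prop := IsPrimeIdeal (⊥ : TwoSidedIdeal A)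

/-! ### Goldie rings -/

/-- The left uniform dimension of `A`: the supremum of the `k` such that `A` contains a direct sum
of `k` nonzero left ideals. -/
noncomputable def leftUniformDim (A : Type u) [Ring A] : ℕ∞ :=
  ⨆ (k : ℕ) (_ : ∃ I : Fin k → Ideal A, iSupIndep I ∧ ∀ i, I i ≠ ⊥), (k : ℕ∞)

/-- The left annihilator `{a ∈ A | a X = 0}` of a subset `X` of `A`. -/
def leftAnn {A : Type u} [Ring A] (X : Set A) : Set A := {a | ∀ x ∈ X, a * x = 0}

/-- `A` is a left Goldie ring: it has finite left uniform dimension and satisfies the ascending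
chain condition on left annihilators. -/
def IsLeftGoldie (A : Type u) [Ring A] : Prop :=
  leftUniformDim A < ⊤ ∧
    ∀ X : ℕ → Set A, Monotone (fun n => leftAnn (X n)) →
      ∃ n, ∀ m, n ≤ m → leftAnn (X m) = leftAnn (X n)

/-- `A` is a `*` Goldie ring for `* ∈ {l, r, ∅}`. -/
def IsGoldie : Side → ∀ (A : Type u) [Ring A], Prop
  | .left, A, _ => IsLeftGoldie A
  | .right, A, _ => IsLeftGoldie Aᵐᵒᵖ
  | .both, A, _ => IsLeftGoldie A ∧ IsLeftGoldie Aᵐᵒᵖ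

/-! ### Classical quotient rings

`nonZeroDivisors A` is the set of regular elements of `A`, and Mathlib's `OreLocalization` is the
ring of left fractions; `OreLocalization.OreSet` holds the data of a left denominator set. -/

/-- The classical left quotient ring `Q_{l,cl}(A)` of `A` exists, i.e. the set of regular elements
is a left denominator set, and there is a ring isomorphism `Q_{l,cl}(A) ≃ Q` that
carries the canonical map `A → Q_{l,cl}(A)` to `f : A → Q`. -/
def IsLeftClassicalQuotient {A : Type u} [Ring A] {Q : Type v} [Ring Q] (f : A →+* Q) : Prop :=
  ∃ _ : OreLocalization.OreSet (nonZeroDivisors A),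
    ∃ e : OreLocalization (nonZeroDivisors A) A ≃+* Q,
      ∀ a : A, e (OreLocalization.numeratorRingHom a) = f a

/-- The same for the classical right quotient ring, which is the opposite ring of the classical
left quotient ring of the opposite ring. -/
def IsRightClassicalQuotient {A : Type u} [Ring A] {Q : Type v} [Ring Q] (f : A →+* Q) : Prop :=
  IsLeftClassicalQuotient (RingHom.op f)

/-- `Q`, via `f : A → Q`, is the classical `*` quotient ring of `A`, for `* ∈ {l, r, ∅}`. -/
def IsClassicalQuotient (side : Side) (A : Type u) [Ring A] (Q : Type v) [Ring Q]
    (f : A →+* Q) : Prop :=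
  match side with
  | .left => IsLeftClassicalQuotient f
  | .right => IsRightClassicalQuotient f
  | .both => IsLeftClassicalQuotient f ∧ IsRightClassicalQuotient f

/-- `𝒞(P)`, the set of elements of `R` whose class is a regular element of `R / P`. -/
def regularModulo {R : Type u} [Ring R] (P : TwoSidedIdeal R) : Submonoid R :=
  (nonZeroDivisors P.ringCon.Quotient).comap P.ringCon.mk'

end LocalizableSets

namespace LocalizableSets

/-! ### The universal property of `R⟨S⁻¹⟩` -/

section UniversalProperty

variable {R : Type u} [Ring R] {S : Submonoid R}

/-! Everything follows from one property of a map `f : R → Q`: each `q` satisfies `f s * q = f r`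
for some `s` with `f s` a unit (`HasLeftFractions`).

If `Q` is simple and Noetherian, the extension to `Q` of a two-sided ideal `I` of `R` is again
two-sided, so it is all of `Q` as soon as `f` does not kill `I`. Clearing the denominator of `1`
then gives an element of `I` that becomes a unit (`HasLeftFractions.exists_isUnit`). Applied to `{z
| f (z R y) = 0}`, this makes the kernel of `f` prime. Applied to `⋂_{j ≠ i} 𝔭_j`, which
irredundancy keeps out of `𝔭_i`, it gives an element invertible in `Q_i` and zero in every other
`Q_j`; with these elements fractions are glued, so `∏ Q_i` is a ring of fractions of `R`.

When `f` is injective and `Q` is Artinian, the regular elements are exactly those with invertible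
image, so `Q` is the classical quotient ring; the Goldie conditions are inherited from the finite
length of `Q`. Right-hand statements are proved in the opposite rings. For maximality, a localizable
`T ⊇ 𝒞(𝔭_i)` yields a map from the simple ring `Q_i` to `R⟨T⁻¹⟩`, which must be injective. -/

theorem toLoc_mul_locInv (s : S) : toLoc S s * locInv S s = 1 := by
  have h := RingQuot.mkRingHom_rel (InvRel.mul_inv s)
  rwa [map_mul, map_one] at h

theorem locInv_mul_toLoc (s : S) : locInv S s * toLoc S s = 1 := by
  have h := RingQuot.mkRingHom_rel (InvRel.inv_mul s)
  rwa [map_mul, map_one] at h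

theorem isUnit_toLoc (s : S) : IsUnit (toLoc S (s : R)) :=
  ⟨⟨toLoc S s, locInv S s, toLoc_mul_locInv s, locInv_mul_toLoc s⟩, rfl⟩

theorem FreeOver.exists_lift {X : Type v} {T : Type*} [Ring T] (f : R →+* T) (g : X → T) :
    ∃ F : FreeOver R X →+* T, (∀ r, F (FreeOver.of R X r) = f r) ∧
      ∀ x, F (FreeOver.var R x) = g x := by
  let G : FreeAlgebra ℤ (R ⊕ X) →+* T := (FreeAlgebra.lift ℤ (Sum.elim f g)).toRingHom
  have hG : ∀ z, G (FreeAlgebra.ι ℤ z) = Sum.elim f g z := fun z =>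
    FreeAlgebra.lift_ι_apply (R := ℤ) (Sum.elim f g) z
  have hrel : ∀ ⦃x y⦄, FreeRel R X x y → G x = G y := by
    intro x y h
    cases h <;> simp [hG]
  refine ⟨RingQuot.lift ⟨G, hrel⟩, fun r => ?_, fun x => ?_⟩
  · exact (RingQuot.lift_mkRingHom_apply G hrel _).trans (hG _)
  · exact (RingQuot.lift_mkRingHom_apply G hrel _).trans (hG _)

theorem FreeOver.hom_ext {X : Type v} {T : Type*} [Ring T] {F G : FreeOver R X →+* T}
    (hof : ∀ r, F (FreeOver.of R X r) = G (FreeOver.of R X r))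
    (hvar : ∀ x, F (FreeOver.var R x) = G (FreeOver.var R x)) : F = G := by
  apply RingQuot.ringQuot_ext
  have h : (F.comp (RingQuot.mkRingHom (FreeRel R X))).toIntAlgHom =
      (G.comp (RingQuot.mkRingHom (FreeRel R X))).toIntAlgHom := by
    apply FreeAlgebra.hom_ext
    funext z
    cases z with
    | inl r => exact hof r
    | inr x => exact hvar x
  ext z
  exact congrArg (fun φ : FreeAlgebra ℤ (R ⊕ X) →ₐ[ℤ] T => φ z) h

theorem exists_loc_lift {T : Type*} [Ring T] (f : R →+* T) (hf : ∀ s ∈ S, IsUnit (f s)) :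
    ∃ F : Loc S →+* T, ∀ r, F (toLoc S r) = f r := by
  obtain ⟨G, hof, hvar⟩ := FreeOver.exists_lift f
    (fun s : S => (((hf s s.2).unit⁻¹ : Tˣ) : T))
  have hrel : ∀ ⦃x y⦄, InvRel S x y → G x = G y := by
    intro x y h
    cases h <;> simp [hof, hvar]
  exact ⟨RingQuot.lift ⟨G, hrel⟩, fun r =>
    (RingQuot.lift_mkRingHom_apply G hrel _).trans (hof r)⟩

theorem map_locInv_eq {T : Type*} [Ring T] {F G : Loc S →+* T}
    (h : ∀ r, F (toLoc S r) = G (toLoc S r)) (s : S) :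
    F (locInv S s) = G (locInv S s) := by
  refine left_inv_eq_right_inv (a := F (toLoc S s)) ?_ ?_
  · rw [← map_mul, locInv_mul_toLoc, map_one]
  · rw [h, ← map_mul, toLoc_mul_locInv, map_one]

theorem loc_hom_ext {T : Type*} [Ring T] {F G : Loc S →+* T}
    (h : ∀ r, F (toLoc S r) = G (toLoc S r)) : F = G :=
  RingQuot.ringQuot_ext _ _ (FreeOver.hom_ext h (map_locInv_eq h))

/-- If the elements of `C ⊇ S` become invertible in `R⟨S⁻¹⟩`, then `R⟨S⁻¹⟩ → R⟨C⁻¹⟩` is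
surjective and `R⟨C⁻¹⟩` maps back to `R⟨S⁻¹⟩`. -/
theorem exists_loc_surjective {C : Submonoid R} (hSC : S ≤ C)
    (hC : ∀ c ∈ C, IsUnit (toLoc S c)) :
    ∃ (F : Loc S →+* Loc C) (_ : Loc C →+* Loc S), Function.Surjective F ∧
      ∀ r, F (toLoc S r) = toLoc C r := by
  obtain ⟨F, hF⟩ := exists_loc_lift (S := S) (T := Loc C) (toLoc C) fun s hs =>
    isUnit_toLoc ⟨s, hSC hs⟩
  obtain ⟨G, hG⟩ := exists_loc_lift (S := C) (T := Loc S) (toLoc S) hC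
  refine ⟨F, G, fun q => ⟨G q, ?_⟩, hF⟩
  have h : F.comp G = RingHom.id _ := loc_hom_ext fun r => by simp [hG, hF]
  exact congrArg (fun φ : Loc C →+* Loc C => φ q) h

theorem map_locInv {C : Submonoid R} (hSC : S ≤ C) {F : Loc S →+* Loc C}
    (hF : ∀ r, F (toLoc S r) = toLoc C r) (s : S) :
    F (locInv S s) = locInv C ⟨s, hSC s.2⟩ := by
  refine left_inv_eq_right_inv (a := toLoc C s) ?_ (toLoc_mul_locInv (⟨s, hSC s.2⟩ : C))
  rw [← hF, ← map_mul, locInv_mul_toLoc, map_one]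

theorem zero_notMem_of_isUnit [Nontrivial (Loc S)] {C : Submonoid R}
    (hC : ∀ c ∈ C, IsUnit (toLoc S c)) : (0 : R) ∉ C := fun h => by
  simpa using hC 0 h

/-- Fractions are carried over by the surjection `Loc S → Loc C`; the map back serves only to show
that `Loc C` is nonzero. -/
theorem IsLeftLocalizable.of_le (hS : IsLeftLocalizable S) {C : Submonoid R} (hSC : S ≤ C)
    (hC : ∀ c ∈ C, IsUnit (toLoc S c)) : IsLeftLocalizable C := by
  have := hS.nontrivial
  obtain ⟨F, G, hsurj, hF⟩ := exists_loc_surjective hSC hC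
  refine ⟨zero_notMem_of_isUnit hC, G.domain_nontrivial, fun q => ?_⟩
  obtain ⟨q, rfl⟩ := hsurj q
  obtain ⟨s, r, rfl⟩ := hS.exists_fraction q
  exact ⟨⟨s, hSC s.2⟩, r, by rw [map_mul, hF, map_locInv hSC hF]⟩

theorem IsRightLocalizable.of_le (hS : IsRightLocalizable S) {C : Submonoid R} (hSC : S ≤ C)
    (hC : ∀ c ∈ C, IsUnit (toLoc S c)) : IsRightLocalizable C := by
  have := hS.nontrivial
  obtain ⟨F, G, hsurj, hF⟩ := exists_loc_surjective hSC hC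
  refine ⟨zero_notMem_of_isUnit hC, G.domain_nontrivial, fun q => ?_⟩
  obtain ⟨q, rfl⟩ := hsurj q
  obtain ⟨r, s, rfl⟩ := hS.exists_fraction q
  exact ⟨r, ⟨s, hSC s.2⟩, by rw [map_mul, hF, map_locInv hSC hF]⟩

theorem IsLocalizable.of_le {side : Side} (hS : IsLocalizable side S) {C : Submonoid R}
    (hSC : S ≤ C) (hC : ∀ c ∈ C, IsUnit (toLoc S c)) : IsLocalizable side C :=
  match side, hS with
  | .left, hS => IsLeftLocalizable.of_le hS hSC hC
  | .right, hS => IsRightLocalizable.of_le hS hSC hC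
  | .both, hS => ⟨IsLeftLocalizable.of_le hS.1 hSC hC, IsRightLocalizable.of_le hS.2 hSC hC⟩

theorem IsLocalizable.nontrivial {side : Side} (hS : IsLocalizable side S) :
    Nontrivial (Loc S) :=
  match side, hS with
  | .left, hS => IsLeftLocalizable.nontrivial hS
  | .right, hS => IsRightLocalizable.nontrivial hS
  | .both, hS => hS.1.nontrivial

theorem mem_ass {r : R} : r ∈ ass S ↔ toLoc S r = 0 := TwoSidedIdeal.mem_ker _

theorem assQuotToLoc_mk (r : R) : assQuotToLoc S ((ass S).ringCon.mk' r) = toLoc S r := rfl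

theorem assQuotToLoc_injective : Function.Injective (assQuotToLoc S) := by
  intro x y h
  obtain ⟨x, rfl⟩ := (ass S).ringCon.mk'_surjective x
  obtain ⟨y, rfl⟩ := (ass S).ringCon.mk'_surjective y
  exact Quotient.sound h

end UniversalProperty

/-! ### Rings of left fractions -/

/-- Every element of `Q` is a left fraction `f(s)⁻¹ f(r)`. -/
def HasLeftFractions {R : Type*} [Ring R] {Q : Type*} [Ring Q] (f : R →+* Q) : Prop :=
  ∀ q : Q, ∃ s r : R, IsUnit (f s) ∧ f s * q = f r

section Fractions

variable {R : Type*} [Ring R] {Q : Type*} [Ring Q] {f : R →+* Q}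

/-- Denominators need only become units in `Q`, not lie in a fixed set. This is what lets the
property pass from `R` to `R / ass(S)`. -/
theorem HasLeftFractions.of_comp {A : Type*} [Ring A] {g : A →+* Q} {h : R →+* A}
    (hf : HasLeftFractions f) (hgh : ∀ r, g (h r) = f r) : HasLeftFractions g := fun q => by
  obtain ⟨s, r, hs, hq⟩ := hf q
  exact ⟨h s, h r, by rwa [hgh], by rw [hgh, hgh, hq]⟩

/-- The left Ore condition. -/
theorem HasLeftFractions.exists_mul_eq (hf : HasLeftFractions f) (r : R) {s : R}
    (hs : IsUnit (f s)) : ∃ u v : R, IsUnit (f u) ∧ f (u * r) = f (v * s) := by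
  obtain ⟨c, hc⟩ := hs
  obtain ⟨u, v, hu, huv⟩ := hf (f r * ((c⁻¹ : Qˣ) : Q))
  refine ⟨u, v, hu, ?_⟩
  rw [map_mul, map_mul, ← huv, ← hc, mul_assoc, mul_assoc, Units.inv_mul, mul_one]

/-- The elements of the extension of a left ideal `I` are the fractions with numerators in `I`. -/
theorem HasLeftFractions.exists_of_mem_map (hf : HasLeftFractions f) {I : Ideal R} {q : Q}
    (hq : q ∈ I.map f) : ∃ s : R, ∃ a ∈ I, IsUnit (f s) ∧ f s * q = f a := by
  induction hq using Submodule.span_induction with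
  | mem x hx =>
    obtain ⟨a, ha, rfl⟩ := hx
    exact ⟨1, a, ha, by simp, by simp⟩
  | zero => exact ⟨1, 0, I.zero_mem, by simp, by simp⟩
  | add x y _ _ hx hy =>
    obtain ⟨s, a, ha, hs, hx⟩ := hx
    obtain ⟨t, b, hb, ht, hy⟩ := hy
    -- `u * s` and `v * t` have the same image, which is a common denominator of `x` and `y`.
    obtain ⟨u, v, hu, huv⟩ := hf.exists_mul_eq s ht
    refine ⟨u * s, u * a + v * b, I.add_mem (I.mul_mem_left _ ha) (I.mul_mem_left _ hb),
      by simpa using hu.mul hs, ?_⟩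
    rw [mul_add, map_add, map_mul f u a, map_mul f v b, ← hx, ← hy, ← mul_assoc, ← mul_assoc,
      ← map_mul f v t, ← huv, map_mul]
  | smul p x _ hx =>
    obtain ⟨s, a, ha, hs, hx⟩ := hx
    obtain ⟨t, r, ht, hr⟩ := hf p
    obtain ⟨u, v, hu, huv⟩ := hf.exists_mul_eq r hs
    refine ⟨u * t, v * a, I.mul_mem_left _ ha, by simpa using hu.mul ht, ?_⟩
    rw [map_mul f v a, ← hx, ← mul_assoc, ← map_mul f v s, ← huv, map_mul, map_mul, ← hr,
      smul_eq_mul]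
    simp only [mul_assoc]

/-- The extension of a two-sided ideal to a left Noetherian ring of left fractions is a
two-sided ideal. -/
theorem HasLeftFractions.mul_mem_map [IsNoetherianRing Q] (hf : HasLeftFractions f)
    (I : TwoSidedIdeal R) {q : Q} (hq : q ∈ I.asIdeal.map f) (w : Q) :
    q * w ∈ I.asIdeal.map f := by
  set L : Ideal Q := I.asIdeal.map f with hL
  have hmul : ∀ {x : Q}, x ∈ L → ∀ r : R, x * f r ∈ L := by
    intro x hx r
    induction hx using Submodule.span_induction with
    | mem x hx =>
      obtain ⟨a, ha, rfl⟩ := hx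
      rw [← map_mul]
      exact Ideal.mem_map_of_mem f
        (TwoSidedIdeal.mem_asIdeal.2 (I.mul_mem_right _ _ (TwoSidedIdeal.mem_asIdeal.1 ha)))
    | zero => simp
    | add x y _ _ hx hy => rw [add_mul]; exact L.add_mem hx hy
    | smul p x _ hx => rw [smul_eq_mul, mul_assoc]; exact L.mul_mem_left _ hx
  obtain ⟨s, r, ⟨c, hc⟩, hr⟩ := hf w
  have hinv : ∀ x ∈ L, x * ((c⁻¹ : Qˣ) : Q) ∈ L := by
    -- The left ideals `{x | x cⁿ ∈ L}` increase because `L c ⊆ L`. Once the chain is stationary at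
    -- `n`, `x c⁻⁽ⁿ⁺¹⁾` lies in the term of index `n + 1`, hence in that of index `n`, which says `x
    -- c⁻¹ ∈ L`.
    let N : ℕ →o Submodule Q Q :=
      { toFun := fun n => Submodule.comap (LinearMap.toSpanSingleton Q Q ((c : Q) ^ n)) L
        monotone' := monotone_nat_of_le_succ fun n x hx => by
          have hx' : x * (c : Q) ^ n ∈ L := hx
          change x * (c : Q) ^ (n + 1) ∈ L
          have h := hmul hx' s
          rwa [← hc, mul_assoc, ← pow_succ] at h }
    obtain ⟨n, hn⟩ := monotone_stabilizes_iff_noetherian.2 ‹IsNoetherianRing Q› N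
    intro x hx
    have h1 : x * ((c⁻¹ ^ (n + 1) : Qˣ) : Q) ∈ N (n + 1) := by
      change x * ((c⁻¹ ^ (n + 1) : Qˣ) : Q) * (c : Q) ^ (n + 1) ∈ L
      rw [mul_assoc, ← Units.val_pow_eq_pow_val, ← Units.val_mul]
      simpa using hx
    rw [← hn (n + 1) n.le_succ] at h1
    have h2 : x * ((c⁻¹ ^ (n + 1) : Qˣ) : Q) * (c : Q) ^ n ∈ L := h1
    rw [mul_assoc, ← Units.val_pow_eq_pow_val, ← Units.val_mul] at h2
    simpa [pow_succ'] using h2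
  have hw : w = ((c⁻¹ : Qˣ) : Q) * f r := by
    rw [← hr, ← hc, ← mul_assoc, Units.inv_mul, one_mul]
  rw [hw, ← mul_assoc]
  exact hmul (hinv q hq) r

/-- A two-sided ideal not contained in the kernel contains an element that becomes invertible. -/
theorem HasLeftFractions.exists_isUnit [IsNoetherianRing Q] [IsSimpleRing Q]
    (hf : HasLeftFractions f) (I : TwoSidedIdeal R) {x : R} (hx : x ∈ I) (hx0 : f x ≠ 0) :
    ∃ d ∈ I, IsUnit (f d) := by
  let J : TwoSidedIdeal Q := TwoSidedIdeal.mk' (I.asIdeal.map f : Set Q) (Submodule.zero_mem _)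
    (Submodule.add_mem _) (Submodule.neg_mem _) (fun h => Ideal.mul_mem_left _ _ h)
    (fun h => hf.mul_mem_map I h _)
  have hJ : ∀ {q}, q ∈ J ↔ q ∈ I.asIdeal.map f := TwoSidedIdeal.mem_mk' ..
  have hxJ : f x ∈ J := hJ.2 (Ideal.mem_map_of_mem f (TwoSidedIdeal.mem_asIdeal.2 hx))
  have hone : (1 : Q) ∈ J := by
    rcases eq_bot_or_eq_top J with h | h
    · rw [h] at hxJ
      exact absurd (by simpa using hxJ) hx0
    · rw [h]; trivial
  obtain ⟨s, d, hd, hs, hsd⟩ := hf.exists_of_mem_map (hJ.1 hone)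
  exact ⟨d, TwoSidedIdeal.mem_asIdeal.1 hd, by rwa [← hsd, mul_one]⟩

/-- If `f x ≠ 0`, the ideal `{z | f (z R y) = 0}` contains some `d` with `f d` a unit, and `f (d *
y) = 0` forces `f y = 0`. -/
theorem HasLeftFractions.eq_zero_or_eq_zero [IsNoetherianRing Q] [IsSimpleRing Q]
    (hf : HasLeftFractions f) {x y : R} (h : ∀ r, f (x * r * y) = 0) : f x = 0 ∨ f y = 0 := by
  by_contra! hxy
  let I : TwoSidedIdeal R := TwoSidedIdeal.mk' {z | ∀ r, f (z * r * y) = 0} (by simp)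
    (fun {a b} ha hb r => by simp [add_mul] at ha hb ⊢; simp [ha r, hb r])
    (fun {a} ha r => by simpa using ha r)
    (fun {a b} hb r => by
      have := hb r
      simp only [map_mul] at this ⊢
      simp only [mul_assoc] at this ⊢
      rw [this, mul_zero])
    (fun {a b} ha r => by simpa [mul_assoc] using ha (b * r))
  have hI : ∀ {z}, z ∈ I ↔ ∀ r, f (z * r * y) = 0 := TwoSidedIdeal.mem_mk' ..
  obtain ⟨d, hd, hu⟩ := hf.exists_isUnit I (hI.2 h) hxy.1
  have h1 := hI.1 hd 1
  rw [mul_one, map_mul] at h1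
  exact hxy.2 (hu.mul_right_eq_zero.1 h1)

/-- Describing `P` by membership covers both `ass S` in `R` and `⊥` in `R / ass(S)`. -/
theorem isPrimeIdeal_of_mem_iff {A : Type u} [Ring A] [Nontrivial Q] {f : A →+* Q}
    (hf : ∀ x y, (∀ r, f (x * r * y) = 0) → f x = 0 ∨ f y = 0) {P : TwoSidedIdeal A}
    (hP : ∀ x, x ∈ P ↔ f x = 0) : IsPrimeIdeal P := by
  refine ⟨fun h => ?_, fun I J hIJ => ?_⟩
  · have : (1 : A) ∈ P := by rw [h]; trivial
    rw [hP, map_one] at this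
    exact one_ne_zero this
  · by_contra! h
    obtain ⟨x, hxI, hx⟩ := Set.not_subset.1 h.1
    obtain ⟨y, hyJ, hy⟩ := Set.not_subset.1 h.2
    rcases hf x y fun r => (hP _).1 (hIJ _ (I.mul_mem_right _ _ hxI) _ hyJ) with h0 | h0
    · exact hx ((hP _).2 h0)
    · exact hy ((hP _).2 h0)

/-! ### Regular elements, classical quotient rings and Goldie conditions. -/

theorem HasLeftFractions.isUnit_of_mem_nonZeroDivisors [IsArtinianRing Q]
    (hf : HasLeftFractions f) (hinj : Function.Injective f) {c : R}
    (hc : c ∈ nonZeroDivisors R) : IsUnit (f c) := by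
  -- In an Artinian ring cancellation on one side suffices, and `q * f c = 0` descends to `R` after
  -- clearing the denominator of `q`.
  rw [IsArtinianRing.isUnit_iff_isRightRegular, isRightRegular_iff_left_eq_zero_of_mul]
  intro q hq
  obtain ⟨s, r, hs, hr⟩ := hf q
  have h0 : f (r * c) = 0 := by rw [map_mul, ← hr, mul_assoc, hq, mul_zero]
  have hr0 : r = 0 := hc.2 r ((map_eq_zero_iff f hinj).1 h0)
  rw [hr0, map_zero] at hr
  exact hs.mul_right_eq_zero.1 hr

theorem mem_nonZeroDivisors_of_isUnit_map (hinj : Function.Injective f) {c : R}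
    (hc : IsUnit (f c)) : c ∈ nonZeroDivisors R := by
  refine mem_nonZeroDivisors_iff.2 ⟨fun x hx => ?_, fun x hx => ?_⟩
  · have := congrArg f hx
    rw [map_mul, map_zero, hc.mul_right_eq_zero] at this
    exact (map_eq_zero_iff f hinj).1 this
  · have := congrArg f hx
    rw [map_mul, map_zero, hc.mul_left_eq_zero] at this
    exact (map_eq_zero_iff f hinj).1 this

theorem HasLeftFractions.isLeftClassicalQuotient {A : Type u} [Ring A] {Q : Type v} [Ring Q]
    {f : A →+* Q} [IsArtinianRing Q] (hf : HasLeftFractions f) (hinj : Function.Injective f) :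
    IsLeftClassicalQuotient f := by
  have hunit : ∀ c : nonZeroDivisors A, IsUnit (f c) := fun c =>
    hf.isUnit_of_mem_nonZeroDivisors hinj c.2
  have hore : ∀ (r : A) (s : nonZeroDivisors A), ∃ (v : A) (u : nonZeroDivisors A),
      (u : A) * r = v * s := fun r s => by
    obtain ⟨u, v, hu, huv⟩ := hf.exists_mul_eq r (hunit s)
    exact ⟨v, ⟨u, mem_nonZeroDivisors_of_isUnit_map hinj hu⟩, hinj huv⟩
  choose num denom heq using hore
  let _ : OreLocalization.OreSet (nonZeroDivisors A) :=
    { ore_right_cancel := fun r₁ r₂ s h => ⟨1, by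
        have h0 : (r₁ - r₂) * (s : A) = 0 := by rw [sub_mul, h, sub_self]
        rw [sub_eq_zero.1 (s.2.2 _ h0)]⟩
      oreNum := num
      oreDenom := denom
      ore_eq := heq }
  let fS : nonZeroDivisors A →* Qˣ :=
    { toFun := fun c => (hunit c).unit
      map_one' := Units.ext (by simp)
      map_mul' := fun a b => Units.ext (by simp) }
  have hfS : ∀ s : nonZeroDivisors A, f s = fS s := fun s => rfl
  let φ := OreLocalization.universalHom f fS hfS
  have hφ : Function.Bijective φ := by
    constructor
    · rw [injective_iff_map_eq_zero]
      intro x hx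
      induction x using OreLocalization.ind with
      | _ r s =>
      rw [OreLocalization.universalHom_apply] at hx
      have h0 : f r = 0 := by simpa using hx
      rw [(map_eq_zero_iff f hinj).1 h0, OreLocalization.zero_oreDiv]
    · intro q
      obtain ⟨s, r, hs, hr⟩ := hf q
      refine ⟨OreLocalization.oreDiv r ⟨s, mem_nonZeroDivisors_of_isUnit_map hinj hs⟩, ?_⟩
      rw [OreLocalization.universalHom_apply, Units.inv_mul_eq_iff_eq_mul, ← hr]
      rfl
  exact ⟨inferInstance, RingEquiv.ofBijective φ hφ, fun a =>
    OreLocalization.universalHom_commutes f fS hfS⟩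

/-- Independent families of left ideals have at most as many nonzero members as the length
of the ring of fractions. -/
theorem HasLeftFractions.le_length (hf : HasLeftFractions f) (hinj : Function.Injective f)
    {k : ℕ} {I : Fin k → Ideal R} (hI : iSupIndep I) (hne : ∀ i, I i ≠ ⊥) :
    (k : ℕ∞) ≤ Module.length Q Q := by
  -- The partial sums of the family, extended to `Q`, form a chain with `k` strict steps. If a step
  -- were an equality, a nonzero `x ∈ I i` would have a multiple `s * x` in `I i ∩ J i = 0` with `f
  -- s` a unit.
  let J : ℕ → Ideal R := fun m => ⨆ (i : Fin k) (_ : (i : ℕ) < m), I i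
  have hJ : Monotone J := fun m m' h =>
    iSup_mono fun i => iSup_le fun hi => le_iSup_of_le (hi.trans_le h) le_rfl
  let c : LTSeries (Ideal Q) :=
    { length := k
      toFun := fun m => (J m).map f
      step := fun i => by
        refine lt_of_le_of_ne (Ideal.map_mono (hJ (by simp))) fun heq => ?_
        obtain ⟨x, hx, hx0⟩ := Submodule.exists_mem_ne_zero_of_ne_bot (hne i)
        have hxJ : f x ∈ (J (i.castSucc : ℕ)).map f := by
          rw [heq]
          refine Ideal.mem_map_of_mem f ?_
          exact (le_iSup₂_of_le (f := fun (j : Fin k) (_ : (j : ℕ) < (i.succ : ℕ)) => I j)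
            i (by simp) le_rfl) hx
        obtain ⟨s, a, ha, hs, hsa⟩ := hf.exists_of_mem_map hxJ
        have hsx : s * x = a := hinj (by rw [map_mul, hsa])
        have hle : J (i.castSucc : ℕ) ≤ ⨆ (j) (_ : j ≠ i), I j :=
          iSup_mono fun j => iSup_le fun hj =>
            le_iSup_of_le (fun h => by subst h; simp at hj) le_rfl
        have h0 : a = 0 := by
          have := (Submodule.disjoint_def.1 (hI i)) a (hsx ▸ (I i).mul_mem_left s hx) (hle ha)
          exact this
        rw [h0, map_zero, hs.mul_right_eq_zero] at hsa
        exact hx0 ((map_eq_zero_iff f hinj).1 hsa) }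
  have h := Order.LTSeries.length_le_krullDim c
  rw [← Module.coe_length] at h
  exact_mod_cast h

theorem HasLeftFractions.isLeftGoldie {A : Type u} [Ring A] {f : A →+* Q} [IsArtinianRing Q]
    (hf : HasLeftFractions f) (hinj : Function.Injective f) : IsLeftGoldie A := by
  refine ⟨lt_of_le_of_lt (iSup₂_le fun k hk => ?_) (lt_top_iff_ne_top.2
    (Module.length_ne_top (R := Q) (M := Q))), fun X hX => ?_⟩
  · obtain ⟨I, hI, hne⟩ := hk
    exact hf.le_length hinj hI hne
  · let L : ℕ → Ideal A := fun n =>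
      { carrier := leftAnn (X n)
        add_mem' := fun ha hb x hx => by rw [add_mul, ha x hx, hb x hx, add_zero]
        zero_mem' := fun x _ => zero_mul x
        smul_mem' := fun c a ha x hx => by rw [smul_eq_mul, mul_assoc, ha x hx, mul_zero] }
    -- Left annihilators are contracted from their extensions, so a chain of them stabilizes when
    -- its extension to `Q` does.
    have hL : ∀ n a, f a ∈ (L n).map f → a ∈ leftAnn (X n) := by
      intro n a ha x hx
      obtain ⟨s, b, hb, hs, hsb⟩ := hf.exists_of_mem_map ha
      have hbx : b * x = 0 := hb x hx
      have h0 : f s * f (a * x) = 0 := by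
        rw [map_mul, ← mul_assoc, hsb, ← map_mul, hbx, map_zero]
      exact (map_eq_zero_iff f hinj).1 (hs.mul_right_eq_zero.1 h0)
    let N : ℕ →o Submodule Q Q :=
      { toFun := fun n => (L n).map f
        monotone' := fun m n h => Ideal.map_mono (hX h) }
    obtain ⟨n, hn⟩ := monotone_stabilizes_iff_noetherian.2
      (inferInstance : IsNoetherian Q Q) N
    refine ⟨n, fun m hm => (hX hm).antisymm' fun a ha => hL n a ?_⟩
    have h1 : f a ∈ N m := Ideal.mem_map_of_mem f (show a ∈ L m from ha)
    rw [← hn m hm] at h1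
    exact h1

end Fractions

/-! ### Rings of right fractions -/

/-- Every element of `Q` is a right fraction `f(r) f(s)⁻¹`. -/
def HasRightFractions {R : Type*} [Ring R] {Q : Type*} [Ring Q] (f : R →+* Q) : Prop :=
  ∀ q : Q, ∃ r s : R, IsUnit (f s) ∧ q * f s = f r

section RightFractions

variable {R : Type*} [Ring R] {Q : Type*} [Ring Q] {f : R →+* Q}

theorem HasRightFractions.of_comp {A : Type*} [Ring A] {g : A →+* Q} {h : R →+* A}
    (hf : HasRightFractions f) (hgh : ∀ r, g (h r) = f r) : HasRightFractions g := fun q => by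
  obtain ⟨r, s, hs, hq⟩ := hf q
  exact ⟨h r, h s, by rwa [hgh], by rw [hgh, hgh, hq]⟩

/-- `IsArtinianRing` is a left-hand condition, but simple Artinian rings are semisimple, a
left-right symmetric notion; hence the left-hand results apply over `Qᵐᵒᵖ`. -/
theorem HasRightFractions.op (hf : HasRightFractions f) : HasLeftFractions f.op := fun q => by
  obtain ⟨r, s, hs, hr⟩ := hf q.unop
  exact ⟨.op s, .op r, hs.op, MulOpposite.unop_injective hr⟩

theorem op_injective (hinj : Function.Injective f) : Function.Injective f.op := fun _ _ h =>
  MulOpposite.unop_injective (hinj (MulOpposite.op_injective h))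

theorem HasRightFractions.eq_zero_or_eq_zero [IsArtinianRing Q] [IsSimpleRing Q]
    (hf : HasRightFractions f) {x y : R} (h : ∀ r, f (x * r * y) = 0) :
    f x = 0 ∨ f y = 0 := by
  have h' := hf.op.eq_zero_or_eq_zero (x := .op y) (y := .op x) fun r =>
    MulOpposite.unop_injective (by simpa [mul_assoc] using h r.unop)
  simpa using h'.symm

theorem HasRightFractions.isUnit_of_mem_nonZeroDivisors [IsArtinianRing Q] [IsSimpleRing Q]
    (hf : HasRightFractions f) (hinj : Function.Injective f) {c : R}
    (hc : c ∈ nonZeroDivisors R) : IsUnit (f c) := by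
  have hop : MulOpposite.op c ∈ nonZeroDivisors Rᵐᵒᵖ := mem_nonZeroDivisors_iff.2
    ⟨fun x hx => MulOpposite.unop_injective (hc.2 _ (MulOpposite.op_injective hx)),
      fun x hx => MulOpposite.unop_injective (hc.1 _ (MulOpposite.op_injective hx))⟩
  exact (hf.op.isUnit_of_mem_nonZeroDivisors (op_injective hinj) hop).unop

/-- Semisimplicity is assumed instead of simplicity so that finite products are covered. -/
theorem HasRightFractions.isRightClassicalQuotient {A : Type u} [Ring A] {Q : Type v} [Ring Q]
    {f : A →+* Q} [IsSemisimpleRing Q] (hf : HasRightFractions f)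
    (hinj : Function.Injective f) : IsRightClassicalQuotient f :=
  hf.op.isLeftClassicalQuotient (op_injective hinj)

theorem HasRightFractions.isLeftGoldie_op {A : Type u} [Ring A] {f : A →+* Q}
    [IsSemisimpleRing Q] (hf : HasRightFractions f) (hinj : Function.Injective f) :
    IsLeftGoldie Aᵐᵒᵖ :=
  hf.op.isLeftGoldie (op_injective hinj)

end RightFractions

/-! ### Finite products -/

theorem mem_iInf₂ {R : Type*} [Ring R] {ι : Type*} {p : ι → Prop} {I : ι → TwoSidedIdeal R}
    {x : R} : x ∈ ⨅ (i) (_ : p i), I i ↔ ∀ i, p i → x ∈ I i := by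
  have h : ∀ J : TwoSidedIdeal R, x ∈ J ↔ TwoSidedIdeal.span {x} ≤ J := fun J => by
    rw [TwoSidedIdeal.span_le, Set.singleton_subset_iff, SetLike.mem_coe]
  simp only [h, le_iInf_iff]

section Product

variable {R : Type*} [Ring R] {ι : Type*} {Q : ι → Type*} [∀ i, Ring (Q i)]
  {f : ∀ i, R →+* Q i}

theorem exists_common_left_denominator [Finite ι] [∀ i, IsNoetherianRing (Q i)]
    [∀ i, IsSimpleRing (Q i)] (hf : ∀ i, HasLeftFractions (f i))
    (hx : ∀ i, ∃ x, f i x ≠ 0 ∧ ∀ j, j ≠ i → f j x = 0) (q : ∀ i, Q i) :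
    ∃ s r : R, ∀ i, IsUnit (f i s) ∧ f i s * q i = f i r := by
  classical
  cases nonempty_fintype ι
  have hc : ∀ i, ∃ d, IsUnit (f i d) ∧ ∀ j, j ≠ i → f j d = 0 := fun i => by
    obtain ⟨x, hx0, hx⟩ := hx i
    obtain ⟨d, hd, hu⟩ := (hf i).exists_isUnit
      (⨅ (j) (_ : j ≠ i), TwoSidedIdeal.ker (f j)) (x := x)
      (by simpa [mem_iInf₂, TwoSidedIdeal.mem_ker] using hx) hx0
    exact ⟨d, hu, by simpa [mem_iInf₂, TwoSidedIdeal.mem_ker] using hd⟩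
  choose d hd hd0 using hc
  choose s r hs hr using fun i => hf i (q i)
  have hsum : ∀ (a : ι → R) (i : ι), f i (∑ j, d j * a j) = f i (d i) * f i (a i) := by
    intro a i
    rw [map_sum, Finset.sum_eq_single i, map_mul]
    · intro j _ hj
      rw [map_mul, hd0 j i hj.symm, zero_mul]
    · simp
  -- In `Q i` only the term `j = i` survives, and there `d i` is a unit multiplying both sides of `s
  -- i * q i = r i` on the left.
  refine ⟨∑ j, d j * s j, ∑ j, d j * r j, fun i => ⟨?_, ?_⟩⟩
  · rw [hsum]
    exact (hd i).mul (hs i)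
  · rw [hsum, hsum, mul_assoc, hr]

theorem HasLeftFractions.pi [Finite ι] [∀ i, IsNoetherianRing (Q i)]
    [∀ i, IsSimpleRing (Q i)] (hf : ∀ i, HasLeftFractions (f i))
    (hx : ∀ i, ∃ x, f i x ≠ 0 ∧ ∀ j, j ≠ i → f j x = 0) :
    HasLeftFractions (RingHom.pi f) := fun q => by
  obtain ⟨s, r, h⟩ := exists_common_left_denominator hf hx q
  exact ⟨s, r, Pi.isUnit_iff.2 fun i => (h i).1, funext fun i => (h i).2⟩

theorem HasRightFractions.pi [Finite ι] [∀ i, IsArtinianRing (Q i)]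
    [∀ i, IsSimpleRing (Q i)] (hf : ∀ i, HasRightFractions (f i))
    (hx : ∀ i, ∃ x, f i x ≠ 0 ∧ ∀ j, j ≠ i → f j x = 0) :
    HasRightFractions (RingHom.pi f) := fun q => by
  obtain ⟨s, r, h⟩ := exists_common_left_denominator (R := Rᵐᵒᵖ) (f := fun i => (f i).op)
    (fun i => (hf i).op)
    (fun i => by
      obtain ⟨x, hx0, hx⟩ := hx i
      exact ⟨.op x, by simpa using hx0, fun j hj => by simpa using hx j hj⟩)
    (fun i => .op (q i))
  exact ⟨r.unop, s.unop, Pi.isUnit_iff.2 fun i => (h i).1.unop,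
    funext fun i => congrArg MulOpposite.unop (h i).2⟩

theorem isLeftClassicalQuotient_pi [Finite ι] [∀ i, IsArtinianRing (Q i)]
    [∀ i, IsSimpleRing (Q i)] (hf : ∀ i, HasLeftFractions (f i))
    (hinj : Function.Injective (RingHom.pi f))
    (hx : ∀ i, ∃ x, f i x ≠ 0 ∧ ∀ j, j ≠ i → f j x = 0) :
    IsLeftClassicalQuotient (RingHom.pi f) :=
  (HasLeftFractions.pi hf hx).isLeftClassicalQuotient hinj

theorem isRightClassicalQuotient_pi [Finite ι] [∀ i, IsArtinianRing (Q i)]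
    [∀ i, IsSimpleRing (Q i)] (hf : ∀ i, HasRightFractions (f i))
    (hinj : Function.Injective (RingHom.pi f))
    (hx : ∀ i, ∃ x, f i x ≠ 0 ∧ ∀ j, j ≠ i → f j x = 0) :
    IsRightClassicalQuotient (RingHom.pi f) :=
  (HasRightFractions.pi hf hx).isRightClassicalQuotient hinj

end Product

/-! ### Localizable sets with simple Artinian localizations -/

section Simple

variable {R : Type u} [Ring R] {S : Submonoid R} {side : Side}

theorem IsLeftLocalizable.hasLeftFractions (hS : IsLeftLocalizable S) :
    HasLeftFractions (Q := Loc S) (toLoc S) := fun q => by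
  obtain ⟨s, r, rfl⟩ := hS.exists_fraction q
  exact ⟨s, r, isUnit_toLoc s, by rw [← mul_assoc, toLoc_mul_locInv, one_mul]⟩

theorem IsRightLocalizable.hasRightFractions (hS : IsRightLocalizable S) :
    HasRightFractions (Q := Loc S) (toLoc S) := fun q => by
  obtain ⟨r, s, rfl⟩ := hS.exists_fraction q
  exact ⟨r, s, isUnit_toLoc s, by rw [mul_assoc, locInv_mul_toLoc, mul_one]⟩

theorem HasLeftFractions.assQuotToLoc (h : HasLeftFractions (Q := Loc S) (toLoc S)) :
    HasLeftFractions (R := (ass S).ringCon.Quotient) (Q := Loc S)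
      (LocalizableSets.assQuotToLoc S) :=
  h.of_comp (h := (ass S).ringCon.mk') assQuotToLoc_mk

theorem HasRightFractions.assQuotToLoc (h : HasRightFractions (Q := Loc S) (toLoc S)) :
    HasRightFractions (R := (ass S).ringCon.Quotient) (Q := Loc S)
      (LocalizableSets.assQuotToLoc S) :=
  h.of_comp (h := (ass S).ringCon.mk') assQuotToLoc_mk

theorem IsLocalizable.hasFractions (hS : IsLocalizable side S) :
    HasLeftFractions (Q := Loc S) (toLoc S) ∨ HasRightFractions (Q := Loc S) (toLoc S) :=
  match side, hS with
  | .left, hS => .inl (IsLeftLocalizable.hasLeftFractions hS)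
  | .right, hS => .inr (IsRightLocalizable.hasRightFractions hS)
  | .both, hS => .inl hS.1.hasLeftFractions

theorem mem_regularModulo_of_isUnit {c : R} (hc : IsUnit (toLoc S c)) :
    c ∈ regularModulo (ass S) :=
  mem_nonZeroDivisors_of_isUnit_map (Q := Loc S) (f := assQuotToLoc S) assQuotToLoc_injective hc

theorem le_regularModulo_ass : S ≤ regularModulo (ass S) := fun s hs =>
  mem_regularModulo_of_isUnit (isUnit_toLoc ⟨s, hs⟩)

variable [IsSimpleRing (Loc S)] [IsArtinianRing (Loc S)]

theorem IsLocalizable.eq_zero_or_eq_zero (hS : IsLocalizable side S) {x y : R}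
    (h : ∀ r, toLoc S (x * r * y) = 0) : toLoc S x = 0 ∨ toLoc S y = 0 :=
  hS.hasFractions.elim (fun hf => hf.eq_zero_or_eq_zero h) fun hf => hf.eq_zero_or_eq_zero h

theorem IsLocalizable.isPrimeIdeal_ass (hS : IsLocalizable side S) : IsPrimeIdeal (ass S) :=
  isPrimeIdeal_of_mem_iff (Q := Loc S) (f := toLoc S) (fun _ _ => hS.eq_zero_or_eq_zero)
    fun _ => mem_ass

theorem IsLocalizable.isPrimeRing (hS : IsLocalizable side S) :
    IsPrimeRing (ass S).ringCon.Quotient := by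
  refine isPrimeIdeal_of_mem_iff (Q := Loc S) (f := assQuotToLoc S) (fun x y h => ?_) fun x => ?_
  · obtain ⟨x, rfl⟩ := (ass S).ringCon.mk'_surjective x
    obtain ⟨y, rfl⟩ := (ass S).ringCon.mk'_surjective y
    exact hS.eq_zero_or_eq_zero fun r => h ((ass S).ringCon.mk' r)
  · rw [map_eq_zero_iff _ assQuotToLoc_injective]
    exact TwoSidedIdeal.mem_bot _

theorem IsLocalizable.isGoldie (hS : IsLocalizable side S) :
    IsGoldie side (ass S).ringCon.Quotient := by
  have hl : IsLeftLocalizable S → IsLeftGoldie (ass S).ringCon.Quotient := fun h =>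
    h.hasLeftFractions.assQuotToLoc.isLeftGoldie assQuotToLoc_injective
  have hr : IsRightLocalizable S → IsLeftGoldie (ass S).ringCon.Quotientᵐᵒᵖ := fun h =>
    h.hasRightFractions.assQuotToLoc.isLeftGoldie_op assQuotToLoc_injective
  cases side with
  | left => exact hl hS
  | right => exact hr hS
  | both => exact ⟨hl hS.1, hr hS.2⟩

theorem IsLocalizable.isClassicalQuotient (hS : IsLocalizable side S) :
    IsClassicalQuotient side (ass S).ringCon.Quotient (Loc S) (assQuotToLoc S) := by
  have hl : IsLeftLocalizable S → IsLeftClassicalQuotient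
      (A := (ass S).ringCon.Quotient) (Q := Loc S) (assQuotToLoc S) := fun h =>
    h.hasLeftFractions.assQuotToLoc.isLeftClassicalQuotient assQuotToLoc_injective
  have hr : IsRightLocalizable S → IsRightClassicalQuotient
      (A := (ass S).ringCon.Quotient) (Q := Loc S) (assQuotToLoc S) := fun h =>
    h.hasRightFractions.assQuotToLoc.isRightClassicalQuotient assQuotToLoc_injective
  cases side with
  | left => exact hl hS
  | right => exact hr hS
  | both => exact ⟨hl hS.1, hr hS.2⟩

theorem IsLocalizable.isUnit_toLoc_of_mem_regularModulo (hS : IsLocalizable side S) {c : R}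
    (hc : c ∈ regularModulo (ass S)) : IsUnit (toLoc S c) := by
  have hc' : (ass S).ringCon.mk' c ∈ nonZeroDivisors _ := hc
  rcases hS.hasFractions with hf | hf
  · exact hf.assQuotToLoc.isUnit_of_mem_nonZeroDivisors assQuotToLoc_injective hc'
  · exact hf.assQuotToLoc.isUnit_of_mem_nonZeroDivisors assQuotToLoc_injective hc'

theorem IsLocalizable.maximal_regularModulo (hS : IsLocalizable side S) :
    Maximal (IsLocalizable side) (regularModulo (ass S)) := by
  refine ⟨hS.of_le le_regularModulo_ass fun c => hS.isUnit_toLoc_of_mem_regularModulo,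
    fun T hT hle t ht => ?_⟩
  have := hT.nontrivial
  obtain ⟨F, hF⟩ := exists_loc_lift (S := S) (T := Loc T) (toLoc T) fun s hs =>
    isUnit_toLoc ⟨s, hle (le_regularModulo_ass hs)⟩
  -- `F` is injective since `Loc S` is simple and `Loc T` nonzero. So `R / ass(S)` embeds in `Loc
  -- T`, where `t` is a unit, and `t` is regular modulo `ass S`.
  have hinj : Function.Injective (F.comp (assQuotToLoc S)) :=
    F.injective.comp assQuotToLoc_injective
  refine mem_nonZeroDivisors_of_isUnit_map hinj ?_
  change IsUnit (F (toLoc S t))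
  rw [hF]
  exact isUnit_toLoc ⟨t, ht⟩

end Simple

/-! ### Minimal primes -/

theorem IsPrimeIdeal.exists_le_of_iInf_le {R : Type u} [Ring R] {P : TwoSidedIdeal R}
    (hP : IsPrimeIdeal P) {ι : Type*} [Finite ι] {p : ι → TwoSidedIdeal R}
    (h : (⨅ i, p i) ≤ P) : ∃ i, p i ≤ P := by
  classical
  cases nonempty_fintype ι
  have key : ∀ s : Finset ι, (⨅ i ∈ s, p i) ≤ P → ∃ i, p i ≤ P := by
    intro s
    induction s using Finset.induction_on with
    | empty => exact fun h => absurd (top_le_iff.1 (by simpa using h)) hP.1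
    | insert a s _ ih =>
      intro h
      rw [Finset.iInf_insert] at h
      rcases hP.2 (p a) (⨅ i ∈ s, p i) fun x hx y hy =>
        h ⟨(p a).mul_mem_right _ _ hx, TwoSidedIdeal.mul_mem_left _ _ _ hy⟩ with h | h
      · exact ⟨a, h⟩
      · exact ih h
  exact key Finset.univ (by simpa using h)

theorem minPrimes_eq_range {R : Type u} [Ring R] {ι : Type*} [Finite ι]
    {p : ι → TwoSidedIdeal R} (hp : ∀ i, IsPrimeIdeal (p i)) (hinter : (⨅ i, p i) = ⊥)
    (hirr : ∀ i, (⨅ (j) (_ : j ≠ i), p j) ≠ ⊥) : minPrimes R = Set.range p := by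
  have hex : ∀ P, IsPrimeIdeal P → ∃ i, p i ≤ P := fun P hP =>
    hP.exists_le_of_iInf_le (hinter.trans_le bot_le)
  have hinc : ∀ i j, p j ≤ p i → j = i := by
    intro i j hji
    by_contra hne
    -- If `p j ≤ p i` with `j ≠ i`, dropping `p i` leaves the intersection unchanged, against
    -- irredundancy.
    refine hirr i (le_bot_iff.1 (hinter ▸ le_iInf fun k => ?_))
    by_cases hk : k = i
    · subst hk
      exact (iInf₂_le j hne).trans hji
    · exact iInf₂_le k hk
  ext P
  constructor
  · intro hP
    obtain ⟨i, hi⟩ := hex P hP.1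
    exact ⟨i, hi.antisymm (hP.2 (hp i) hi)⟩
  · rintro ⟨i, rfl⟩
    refine ⟨hp i, fun P hP hle => ?_⟩
    obtain ⟨j, hj⟩ := hex P hP
    rwa [hinc i j (hj.trans hle)] at hj

/-! ### The classical quotient ring of `R` -/

section Main

variable {R : Type u} [Ring R] {n : ℕ} {S : Fin n → Submonoid R}

theorem pi_toLoc_injective (hinter : (⨅ i, ass (S i)) = ⊥) :
    Function.Injective (RingHom.pi fun i => toLoc (S i)) := by
  rw [injective_iff_map_eq_zero]
  intro x hx
  have h : x ∈ ⨅ i, ass (S i) := (TwoSidedIdeal.mem_iInf _).2 fun i => mem_ass.2 (congrFun hx i)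
  rw [hinter] at h
  exact (TwoSidedIdeal.mem_bot _).1 h

/-- A nonzero element of the intersection of the other kernels cannot lie in `ass (S i)`, the total
intersection being zero. -/
theorem exists_toLoc_ne_zero (hinter : (⨅ i, ass (S i)) = ⊥)
    (hirr : ∀ i, (⨅ (j : Fin n) (_ : j ≠ i), ass (S j)) ≠ ⊥) (i : Fin n) :
    ∃ x, toLoc (S i) x ≠ 0 ∧ ∀ j, j ≠ i → toLoc (S j) x = 0 := by
  by_contra! h
  refine hirr i (le_bot_iff.1 fun x hx => ?_)
  have hx' : ∀ j, j ≠ i → toLoc (S j) x = 0 := by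
    simpa [mem_iInf₂, mem_ass] using hx
  have h0 : toLoc (S i) x = 0 := by
    by_contra h0
    obtain ⟨j, hj, hjx⟩ := h x h0
    exact hjx (hx' j hj)
  rw [← hinter, TwoSidedIdeal.mem_iInf]
  intro j
  by_cases hj : j = i
  · exact hj ▸ mem_ass.2 h0
  · exact mem_ass.2 (hx' j hj)

theorem isClassicalQuotient_pi {side : Side} (hS : ∀ i, IsLocalizable side (S i))
    [∀ i, IsSimpleRing (Loc (S i))] [∀ i, IsArtinianRing (Loc (S i))]
    (hinter : (⨅ i, ass (S i)) = ⊥)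
    (hirr : ∀ i, (⨅ (j : Fin n) (_ : j ≠ i), ass (S j)) ≠ ⊥) :
    IsClassicalQuotient side R (∀ i, Loc (S i)) (RingHom.pi fun i => toLoc (S i)) := by
  have hx := exists_toLoc_ne_zero hinter hirr
  have hinj := pi_toLoc_injective hinter
  have hl (h : ∀ i, IsLeftLocalizable (S i)) :=
    isLeftClassicalQuotient_pi (Q := fun i => Loc (S i)) (f := fun i => toLoc (S i))
      (fun i => (h i).hasLeftFractions) hinj hx
  have hr (h : ∀ i, IsRightLocalizable (S i)) :=
    isRightClassicalQuotient_pi (Q := fun i => Loc (S i)) (f := fun i => toLoc (S i))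
      (fun i => (h i).hasRightFractions) hinj hx
  cases side with
  | left => unfold IsClassicalQuotient; exact hl hS
  | right => unfold IsClassicalQuotient; exact hr hS
  | both => unfold IsClassicalQuotient; exact ⟨hl fun i => (hS i).1, hr fun i => (hS i).2⟩

end Main

end LocalizableSets

open LocalizableSets in
theorem mainTheorem3 {R : Type u} [Ring R] (side : Side) (n : ℕ) (S : Fin n → Submonoid R)
    (hS : ∀ i, IsLocalizable side (S i))
    (hsimple : ∀ i, IsSimpleRing (Loc (S i)))
    (hartinian : ∀ i, IsArtinianRing (Loc (S i)))
    (hinter : (⨅ i, ass (S i)) = ⊥)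
    (hirredundant : ∀ i, (⨅ (j : Fin n) (_ : j ≠ i), ass (S j)) ≠ ⊥) :
    (∀ i, IsPrimeRing (ass (S i)).ringCon.Quotient ∧
      IsGoldie side (ass (S i)).ringCon.Quotient) ∧
    minPrimes R = Set.range (fun i => ass (S i)) ∧
    (∀ i, IsClassicalQuotient side (ass (S i)).ringCon.Quotient (Loc (S i)) (assQuotToLoc (S i))) ∧
    (∀ i, S i ≤ regularModulo (ass (S i))) ∧
    IsClassicalQuotient side R (∀ i, Loc (S i)) (RingHom.pi fun i => toLoc (S i)) ∧
    (∀ i, Maximal (IsLocalizable side) (regularModulo (ass (S i)))) := by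
  exact ⟨fun i => ⟨(hS i).isPrimeRing, (hS i).isGoldie⟩,
    minPrimes_eq_range (fun i => (hS i).isPrimeIdeal_ass) hinter hirredundant,
    fun i => (hS i).isClassicalQuotient, fun i => le_regularModulo_ass,
    isClassicalQuotient_pi hS hinter hirredundant, fun i => (hS i).maximal_regularModulo⟩
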